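/- For $n\ge 1$ consider the binomial channel with input $X\in[0,1]$ and output $Y\in\{0,\dots,n\}$, where $P_{Y|X}(y|x)=\binom{n}{y}x^y(1-x)^{n-y}$. Let $I(X;Y)$ denote mutual information, with natural logarithms, and let $C(n)=\sup_{P_X} I(X;Y)$ be the channel capacity, the supremum being over all probability distributions $P_X$ on $[0,1]$. Let $\psi$ be the digamma function. Then for every integer $n\ge 1$, $C(n)$ is finite and $$C(n)\;\ge\;\psi(n+1)-\log\bigl(1+\sqrt{3n+1}\bigr)+\tfrac12\log\frac{3\pi}{2e}.$$ The same lower bound already holds for $I(X_{\mathrm r};Y_{\mathrm r})$, where the input is $X_{\mathrm r}\sim\mathrm{Beta}(1/2,1/2)$ and $Y_{\mathrm r}$ is the corresponding output. In particular, for every $n\ge1$, $$C(n)\;\ge\;\tfrac12\log\frac{n\pi}{2e}+r_{\mathrm{LB}}(n),\qquad r_{\mathrm{LB}}(n):=\tfrac12\log\Bigl(1+\frac1{3n}\Bigr)-\log\Bigl(1+\frac1{\sqrt{3n+1}}\Bigr)-\frac1{n+1},$$ and $r_{\mathrm{LB}}(n)\to0$ as $n\to\infty$. -/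

import Mathlib

namespace BinomialChannel

open MeasureTheory ProbabilityTheory InformationTheory
open scoped ENNReal unitInterval

/-- The mutual information `I(X;Y)` (in nats) between an input `X` with law `μ` and the output `Y`
of the channel `κ`: the relative entropy of the joint law `P_{X,Y} = μ ⊗ₘ κ` with respect to the
product `P_X × P_Y` of the two marginals. -/
noncomputable def mutualInfo {𝓧 𝓨 : Type*} [MeasurableSpace 𝓧] [MeasurableSpace 𝓨]
    (μ : Measure 𝓧) (κ : Kernel 𝓧 𝓨) : ℝ≥0∞ :=
  klDiv (μ ⊗ₘ κ) (μ.prod (κ ∘ₘ μ))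

theorem measurable_binomial (n : ℕ) : Measurable (fun x : I => binomial n x) := by
  refine Measure.measurable_of_measurable_coe _ fun s _ => ?_
  simp only [binomial_eq_sum_dirac, Measure.finsetSum_apply, Measure.smul_apply, smul_eq_mul]
  fun_prop

/-- The binomial channel: the input `x ∈ [0,1]` is sent to a random output `Y ∼ Bin(n, x)`,
i.e. `P_{Y|X}(y|x) = (n choose y) x ^ y (1 - x) ^ (n - y)` for `y = 0, …, n`. -/
noncomputable def channel (n : ℕ) : Kernel I ℕ where
  toFun x := binomial n x
  measurable' := measurable_binomial n

instance (n : ℕ) : IsMarkovKernel (channel n) :=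
  ⟨fun x => inferInstanceAs (IsProbabilityMeasure (binomial n x))⟩

/-- The transition law of the channel, in closed form. -/
theorem channel_real_singleton (n y : ℕ) (x : I) :
    (channel n x).real {y} = (n.choose y : ℝ) * (x : ℝ) ^ y * (1 - (x : ℝ)) ^ (n - y) :=
  binomial_real_singleton n y x

/-- The capacity `C(n)` of the binomial channel (in nats): the largest mutual information over all
input distributions on `[0,1]`. -/
noncomputable def capacity (n : ℕ) : ℝ≥0∞ :=
  ⨆ P : ProbabilityMeasure I, mutualInfo (P : Measure I) (channel n)

/-- The reference input distribution `Beta(1/2, 1/2)`, as a measure on `[0,1]`. -/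
noncomputable def referenceInput : Measure I :=
  (betaMeasure (1 / 2) (1 / 2)).comap Subtype.val

instance : IsProbabilityMeasure referenceInput := by
  constructor
  rw [referenceInput, comap_subtype_coe_apply measurableSet_Icc]
  have := isProbabilityMeasureBeta (α := 1 / 2) (β := 1 / 2) (by norm_num) (by norm_num)
  rw [Set.image_univ, Subtype.range_coe_subtype, Set.ofPred_mem_eq,
    ← prob_compl_eq_zero_iff measurableSet_Icc, betaMeasure,
    withDensity_apply _ (measurableSet_Icc.compl)]
  refine setLIntegral_eq_zero measurableSet_Icc.compl fun x hx => ?_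
  rcases le_or_gt x 0 with h | h
  · exact betaPDF_eq_zero_of_nonpos h
  · exact betaPDF_eq_zero_of_one_le (not_lt.mp fun h1 => hx ⟨h.le, h1.le⟩)

/-- The real digamma function `ψ`. -/
noncomputable def digamma (x : ℝ) : ℝ := (Complex.digamma (x : ℂ)).re

/-- The remainder term of the asymptotic form of the lower bound. -/
noncomputable def rLB (n : ℕ) : ℝ :=
  1 / 2 * Real.log (1 + 1 / (3 * (n : ℝ))) - Real.log (1 + 1 / √(3 * (n : ℝ) + 1))
    - 1 / ((n : ℝ) + 1)

end BinomialChannel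

namespace BinomialChannel

open MeasureTheory ProbabilityTheory InformationTheory Filter Topology
open scoped ENNReal unitInterval

/-! ### Elementary inequalities for the logarithm -/

/-! For the `Beta(1/2, 1/2)` input every expectation is a Beta integral. Put `q = E[P(y|X)]` and `z
= n - y`. In `E[P log P] - q log q` the logarithm of the binomial coefficient cancels, and `E[X^y
(1-X)^z log X]` is the derivative of the Beta integral in its exponent, which brings in `ψ`. Divided
by `q`, the summand of the mutual information is `yψ(y+1/2) - log Γ(y+1/2) + zψ(z+1/2) - log
Γ(z+1/2) + log π + log n! - nψ(n+1)`.

The Stirling-type inequality `kψ(k+1/2) - log Γ(k+1/2) ≥ k - (1/2) log 2π`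
(`log_Gamma_half_add_nat_le`) removes all dependence on `y`. Since the weights `q` sum to 1, `I ≥ n
- log 2 + log n! - nψ(n+1)`. A second inequality of this kind, `le_log_factorial_sub_digamma`, turns
this into the stated bound.

Both inequalities use one device: an antitone sequence is at least its limit, or any limit of
eventual lower bounds. The increments are controlled by bounds on `ψ`, themselves obtained by the
same device from trapezoid and midpoint estimates of `log`. -/

theorem log_sub_log_le {x : ℝ} (hx : 0 < x) :
    Real.log (x + 1) - Real.log x ≤ (1 / x + 1 / (x + 1)) / 2 := by
  have hpos : 0 < (x + 1) / x := by positivity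
  rw [← Real.log_div (by positivity) hx.ne']
  have h1 : 1 ≤ (x + 1) / x := (one_le_div hx).2 (by linarith)
  -- With `t = (x+1)/x` this is `log t ≤ sinh (log t) = (t - 1/t)/2`, the trapezoid bound for `∫
  -- 1/u` over `[x, x+1]`.
  have h := Real.self_le_sinh_iff.2 (Real.log_nonneg h1)
  rw [Real.sinh_log hpos] at h
  refine h.trans (le_of_eq ?_)
  field_simp
  ring

/-- Midpoint bound for the integral of the convex function `1/u` over `[x, x+h]`. -/
theorem le_log_add_sub_log {x h : ℝ} (hx : 0 < x) (hh : 0 ≤ h) :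
    2 * h / (2 * x + h) ≤ Real.log (x + h) - Real.log x := by
  rw [← Real.log_div (by positivity) hx.ne']
  have := Real.le_log_one_add_of_nonneg (x := h / x) (by positivity)
  rw [show (x + h) / x = 1 + h / x by field_simp]
  refine le_of_eq_of_le ?_ this
  field_simp
  ring

/-! ### The real digamma function -/

theorem hasDerivAt_Gamma {x : ℝ} (hx : 0 < x) :
    HasDerivAt Real.Gamma (Real.Gamma x * digamma x) x := by
  have hne : ∀ m : ℕ, (x : ℂ) ≠ -m := fun m h => by
    have := congrArg Complex.re h
    simp at this
    have hm : (0 : ℝ) ≤ m := m.cast_nonneg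
    linarith
  have h := (Complex.differentiableAt_Gamma x hne).hasDerivAt.real_of_complex
  have hG : Real.Gamma x ≠ 0 := (Real.Gamma_pos_of_pos hx).ne'
  simp only [Complex.Gamma_ofReal, Complex.ofReal_re] at h
  convert h using 1
  rw [digamma, Complex.digamma_def, logDeriv_apply, Complex.Gamma_ofReal, Complex.div_ofReal_re]
  field_simp

theorem digamma_add_one {x : ℝ} (hx : 0 < x) : digamma (x + 1) = digamma x + 1 / x := by
  have hne : ∀ m : ℕ, (x : ℂ) ≠ -m := fun m h => by
    have := congrArg Complex.re h
    simp at this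
    have hm : (0 : ℝ) ≤ m := m.cast_nonneg
    linarith
  have := Complex.digamma_apply_add_one x hne
  rw [digamma, digamma, Complex.ofReal_add, Complex.ofReal_one, this, Complex.add_re,
    ← Complex.ofReal_inv, Complex.ofReal_re, one_div]

theorem digamma_one_add_nat (n : ℕ) :
    digamma (1 + n) = harmonic n - Real.eulerMascheroniConstant := by
  induction n with
  | zero => simp [digamma, Complex.digamma_one]
  | succ n ih =>
    have h : (0 : ℝ) < 1 + n := by positivity
    rw [Nat.cast_succ, ← add_assoc, digamma_add_one h, ih, harmonic_succ]
    push_cast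
    rw [add_comm (1 : ℝ) n]
    ring

/-- The increments `1/(k+1/2)` are twice the reciprocals of the odd numbers, whence `2 H_{2n} -
H_n`; the constants come from `ψ(1/2)`. -/
theorem digamma_half_add_nat (n : ℕ) :
    digamma (1 / 2 + n) = 2 * harmonic (2 * n) - harmonic n - 2 * Real.log 2
      - Real.eulerMascheroniConstant := by
  induction n with
  | zero =>
    have h : ((1 / 2 : ℝ) : ℂ) = 1 / 2 := by push_cast; rfl
    have h2 : (Complex.log 2).re = Real.log 2 := by
      rw [show (2 : ℂ) = ((2 : ℝ) : ℂ) by norm_num, Complex.log_ofReal_re]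
    rw [Nat.cast_zero, add_zero, digamma, h, Complex.digamma_one_half]
    simp [h2]
  | succ n ih =>
    have h : (0 : ℝ) < 1 / 2 + n := by positivity
    have h1 : (2 * (n : ℝ) + 1) ≠ 0 := by positivity
    have h2 : ((n : ℝ) + 1) ≠ 0 := by positivity
    rw [Nat.cast_succ, ← add_assoc, digamma_add_one h, ih, Nat.mul_succ, harmonic_succ,
      harmonic_succ, harmonic_succ]
    push_cast
    rw [show (1 / 2 + (n : ℝ)) = (2 * n + 1) / 2 by ring,
      show (2 * (n : ℝ) + 1 + 1) = 2 * (n + 1) by ring]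
    field_simp
    ring

theorem tendsto_digamma_one_add_nat_sub_log :
    Tendsto (fun n : ℕ => digamma (1 + n) - Real.log n) atTop (𝓝 0) := by
  have h := Real.tendsto_harmonic_sub_log.sub_const Real.eulerMascheroniConstant
  rw [sub_self] at h
  refine h.congr fun n => ?_
  rw [digamma_one_add_nat]
  ring

theorem tendsto_digamma_half_add_nat_sub_log :
    Tendsto (fun n : ℕ => digamma (1 / 2 + n) - Real.log n) atTop (𝓝 0) := by
  have h0 := Real.tendsto_harmonic_sub_log
  have h1 : Tendsto (fun n : ℕ => 2 * n) atTop atTop :=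
    tendsto_id.const_mul_atTop' (by norm_num)
  have h := (((h0.comp h1).const_mul 2).sub h0).sub_const Real.eulerMascheroniConstant
  rw [show 2 * Real.eulerMascheroniConstant - Real.eulerMascheroniConstant
    - Real.eulerMascheroniConstant = 0 by ring] at h
  refine h.congr' ?_
  filter_upwards [eventually_ge_atTop 1] with n hn
  have hn' : (n : ℝ) ≠ 0 := by positivity
  simp only [Function.comp_apply]
  rw [digamma_half_add_nat, Nat.cast_mul, Nat.cast_ofNat, Real.log_mul (by norm_num) hn']
  ring

theorem tendsto_log_add_nat_sub_log (a : ℝ) :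
    Tendsto (fun n : ℕ => Real.log (a + n) - Real.log n) atTop (𝓝 0) := by
  refine ((Real.tendsto_log_comp_add_sub_log a).comp tendsto_natCast_atTop_atTop).congr fun n => ?_
  simp [add_comm]

theorem tendsto_one_div_add_nat (a : ℝ) :
    Tendsto (fun n : ℕ => 1 / (a + n)) atTop (𝓝 0) := by
  simp only [one_div]
  exact tendsto_inv_atTop_zero.comp
    (tendsto_atTop_add_const_left _ a tendsto_natCast_atTop_atTop)

/-- By the trapezoid bound, `log x - 1/(2x) - ψ(x)` decreases under unit steps, and it tends to 0
along `a + n`. The hypothesis `h` lets `a = 1/2` and `a = 1` share the argument. -/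
theorem digamma_add_nat_le {a : ℝ} (ha : 0 < a)
    (h : Tendsto (fun n : ℕ => digamma (a + n) - Real.log n) atTop (𝓝 0)) (n : ℕ) :
    digamma (a + n) ≤ Real.log (a + n) - 1 / (2 * (a + n)) := by
  have hanti : Antitone fun n : ℕ =>
      Real.log (a + n) - 1 / 2 * (1 / (a + n)) - digamma (a + n) := by
    refine antitone_nat_of_succ_le fun n => ?_
    have hx : 0 < a + n := by positivity
    rw [Nat.cast_succ, ← add_assoc, digamma_add_one hx]
    have := log_sub_log_le hx
    linarith
  have hlim : Tendsto (fun n : ℕ =>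
      Real.log (a + n) - 1 / 2 * (1 / (a + n)) - digamma (a + n)) atTop (𝓝 0) := by
    have := ((tendsto_log_add_nat_sub_log a).sub
      ((tendsto_one_div_add_nat a).const_mul (1 / 2))).sub h
    simp only [mul_zero, sub_zero] at this
    exact this.congr fun n => by ring
  have := hanti.le_of_tendsto hlim n
  have h2 : 1 / (2 * (a + n)) = 1 / 2 * (1 / (a + n)) := by rw [one_div_mul_one_div]
  linarith

theorem log_le_digamma_half_add_nat {n : ℕ} (hn : 1 ≤ n) :
    Real.log n ≤ digamma (1 / 2 + n) := by
  -- The midpoint of `[m, m+1]` is `m + 1/2`, the argument whose reciprocal `ψ` gains. The shift to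
  -- `n + 1` keeps the logarithm away from 0.
  have hanti : Antitone fun n : ℕ =>
      digamma (1 / 2 + (n + 1 : ℕ)) - Real.log ((n + 1 : ℕ) : ℝ) := by
    refine antitone_nat_of_succ_le fun n => ?_
    have hx : (0 : ℝ) < 1 / 2 + (n + 1 : ℕ) := by positivity
    rw [Nat.cast_succ (n + 1), ← add_assoc, digamma_add_one hx]
    have := le_log_add_sub_log (x := ((n + 1 : ℕ) : ℝ)) (by positivity) zero_le_one
    have e : 2 * 1 / (2 * ((n + 1 : ℕ) : ℝ) + 1) = 1 / (1 / 2 + (n + 1 : ℕ)) := by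
      field_simp
      ring
    linarith
  have hlim := (tendsto_add_atTop_iff_nat 1).2 tendsto_digamma_half_add_nat_sub_log
  have := hanti.le_of_tendsto hlim (n - 1)
  rw [Nat.sub_add_cancel hn] at this
  linarith

/-- Shaped to be exactly the increment needed in `le_log_factorial_sub_digamma`. Here `ψ(n+1) +
1/(n+1)` grows by `1/(n+2)`, and `n+2` is the midpoint of `[n+1, n+3]`. -/
theorem le_digamma_one_add_nat (n : ℕ) :
    1 / 2 * Real.log (1 + n) + 1 / 2 * Real.log (2 + n) - 1 / (1 + (n : ℝ))
      ≤ digamma (1 + n) := by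
  have hanti : Antitone fun n : ℕ => digamma (1 + n) + 1 / (1 + (n : ℝ))
      - 1 / 2 * Real.log (1 + n) - 1 / 2 * Real.log (2 + n) := by
    refine antitone_nat_of_succ_le fun n => ?_
    have hx : (0 : ℝ) < 1 + n := by positivity
    rw [Nat.cast_succ, ← add_assoc, ← add_assoc, digamma_add_one hx]
    have := le_log_add_sub_log hx zero_le_two
    rw [show (1 + (n : ℝ) + 2) = 2 + n + 1 by ring,
      show 2 * 2 / (2 * (1 + (n : ℝ)) + 2) = 2 * (1 / (1 + n + 1)) by field_simp] at this
    rw [show (2 + (n : ℝ)) = 1 + n + 1 by ring] at *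
    linarith
  have hlim : Tendsto (fun n : ℕ => digamma (1 + n) + 1 / (1 + (n : ℝ))
      - 1 / 2 * Real.log (1 + n) - 1 / 2 * Real.log (2 + n)) atTop (𝓝 0) := by
    have := ((tendsto_digamma_one_add_nat_sub_log.add (tendsto_one_div_add_nat 1)).sub
      ((tendsto_log_add_nat_sub_log 1).const_mul (1 / 2))).sub
      ((tendsto_log_add_nat_sub_log 2).const_mul (1 / 2))
    simp only [mul_zero, sub_zero, add_zero] at this
    exact this.congr fun n => by ring
  have := hanti.le_of_tendsto hlim n
  linarith

/-! ### Stirling-type bounds -/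

theorem tendsto_log_factorial_sub :
    Tendsto (fun n : ℕ => Real.log n.factorial - n * Real.log n + n - 1 / 2 * Real.log n) atTop
      (𝓝 (1 / 2 * Real.log (2 * Real.pi))) := by
  have h := (Stirling.tendsto_stirlingSeq_sqrt_pi.log
    (Real.sqrt_ne_zero'.2 Real.pi_pos)).add_const (1 / 2 * Real.log 2)
  rw [Real.log_sqrt Real.pi_pos.le, show Real.log Real.pi / 2 + 1 / 2 * Real.log 2
    = 1 / 2 * Real.log (2 * Real.pi) by
      rw [Real.log_mul two_ne_zero Real.pi_ne_zero]; ring] at h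
  refine h.congr' ?_
  filter_upwards [eventually_ge_atTop 1] with n hn
  have hn' : (n : ℝ) ≠ 0 := by positivity
  rw [Stirling.log_stirlingSeq_formula, Real.log_mul two_ne_zero hn',
    Real.log_div hn' (Real.exp_ne_zero 1), Real.log_exp]
  ring

/-- Log-convexity of `Γ` at the midpoint of `n` and `n + 1`. -/
theorem log_Gamma_half_add_nat_le_log_factorial {n : ℕ} (hn : 1 ≤ n) :
    Real.log (Real.Gamma (1 / 2 + n)) ≤ Real.log n.factorial - 1 / 2 * Real.log n := by
  have hn' : (0 : ℝ) < n := by positivity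
  have hc := Real.convexOn_log_Gamma.2
  have h := hc (Set.mem_Ioi.2 hn') (Set.mem_Ioi.2 (by positivity : (0 : ℝ) < n + 1))
    (by norm_num : (0 : ℝ) ≤ 1 / 2) (by norm_num : (0 : ℝ) ≤ 1 / 2) (by norm_num)
  simp only [smul_eq_mul, Function.comp_apply] at h
  rw [show 1 / 2 * (n : ℝ) + 1 / 2 * (n + 1) = 1 / 2 + n by ring] at h
  have h1 : Real.log n.factorial = Real.log n + Real.log (Real.Gamma n) := by
    rw [← Real.Gamma_nat_eq_factorial, Real.Gamma_add_one hn'.ne',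
      Real.log_mul hn'.ne' (Real.Gamma_pos_of_pos hn').ne']
  rw [Real.Gamma_nat_eq_factorial] at h
  linarith

/-- The gap `D` has increment `ψ(x) + 1/(2x) - log x ≤ 0` at `x = n + 1/2`, and Stirling's formula
supplies eventual lower bounds tending to 0. -/
theorem log_Gamma_half_add_nat_le (n : ℕ) :
    Real.log (Real.Gamma (1 / 2 + n))
      ≤ n * digamma (1 / 2 + n) - n + 1 / 2 * Real.log (2 * Real.pi) := by
  set D : ℕ → ℝ := fun n => n * digamma (1 / 2 + n) - n + 1 / 2 * Real.log (2 * Real.pi)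
    - Real.log (Real.Gamma (1 / 2 + n)) with hD
  have hanti : Antitone D := by
    refine antitone_nat_of_succ_le fun n => ?_
    have hx : (0 : ℝ) < 1 / 2 + n := by positivity
    have hG := Real.Gamma_pos_of_pos hx
    have h := digamma_add_nat_le (by norm_num) tendsto_digamma_half_add_nat_sub_log n
    simp only [hD]
    rw [Nat.cast_succ, ← add_assoc, digamma_add_one hx, Real.Gamma_add_one hx.ne',
      Real.log_mul hx.ne' hG.ne']
    have e : ((n : ℝ) + 1) * (1 / (1 / 2 + n)) = 1 + 1 / (2 * (1 / 2 + n)) := by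
      field_simp
      ring
    nlinarith
  have hlim := tendsto_log_factorial_sub.const_sub (1 / 2 * Real.log (2 * Real.pi))
  rw [sub_self] at hlim
  have : 0 ≤ D n := by
    refine le_of_tendsto hlim ?_
    filter_upwards [eventually_ge_atTop n, eventually_ge_atTop 1] with k hk hk1
    refine le_trans ?_ (hanti hk)
    have h1 := log_Gamma_half_add_nat_le_log_factorial hk1
    have h2 := mul_le_mul_of_nonneg_left (log_le_digamma_half_add_nat hk1) (Nat.cast_nonneg (α := ℝ) k)
    simp only [hD]
    linarith
  simp only [hD] at this
  linarith

theorem le_log_factorial_sub_digamma (n : ℕ) :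
    1 / 2 * Real.log (2 * Real.pi) - 1 / 2
      ≤ n + Real.log n.factorial - (1 + n) * digamma (1 + n) + 1 / 2 * Real.log (1 + n) := by
  set G : ℕ → ℝ := fun n => n + Real.log n.factorial - (1 + n) * digamma (1 + n)
    + 1 / 2 * Real.log (1 + n) with hG
  have hanti : Antitone G := by
    refine antitone_nat_of_succ_le fun n => ?_
    have hx : (0 : ℝ) < 1 + n := by positivity
    have h := le_digamma_one_add_nat n
    simp only [hG]
    rw [Nat.cast_succ, ← add_assoc, digamma_add_one hx, Nat.factorial_succ, Nat.cast_mul,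
      Nat.cast_succ, add_comm (n : ℝ) 1,
      Real.log_mul hx.ne' (by exact_mod_cast n.factorial_ne_zero)]
    rw [show (2 + (n : ℝ)) = 1 + n + 1 by ring] at h
    have e : (1 + (1 + (n : ℝ))) * (1 / (1 + n)) = 1 + 1 / (1 + n) := by
      field_simp
      ring
    nlinarith
  have hlim := ((tendsto_add_atTop_iff_nat 1).2 tendsto_log_factorial_sub).sub_const (1 / 2)
  refine le_of_tendsto hlim ?_
  filter_upwards [eventually_ge_atTop n] with k hk
  refine le_trans ?_ (hanti hk)
  have hx : (0 : ℝ) < 1 + k := by positivity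
  have h := digamma_add_nat_le one_pos tendsto_digamma_one_add_nat_sub_log k
  simp only [hG]
  rw [Nat.cast_succ, Nat.factorial_succ, Nat.cast_mul, Nat.cast_succ, add_comm (k : ℝ) 1,
      Real.log_mul hx.ne' (by exact_mod_cast k.factorial_ne_zero)]
  have h2 := mul_le_mul_of_nonneg_left h hx.le
  rw [mul_sub, show (1 + (k : ℝ)) * (1 / (2 * (1 + k))) = 1 / 2 by field_simp] at h2
  linarith

/-! ### Comparison of the explicit bounds -/

theorem lower_bound_le_log_factorial_sub_digamma {n : ℕ} (hn : 1 ≤ n) :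
    digamma ((n : ℝ) + 1) - Real.log (1 + √(3 * (n : ℝ) + 1))
      + 1 / 2 * Real.log (3 * Real.pi / (2 * Real.exp 1))
    ≤ n - Real.log 2 + Real.log n.factorial - n * digamma ((n : ℝ) + 1) := by
  have h := le_log_factorial_sub_digamma n
  have hπ := Real.pi_pos
  -- Once the constants are cancelled, only `3(n+1) ≤ (1 + √(3n+1))²` is left to compare.
  have h1 : Real.log (1 + n) + Real.log 3 ≤ 2 * Real.log (1 + √(3 * (n : ℝ) + 1)) := by
    have e := Real.log_rpow (show 0 < 1 + √(3 * (n : ℝ) + 1) by positivity) 2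
    rw [Real.rpow_two] at e
    rw [← Real.log_mul (by positivity) (by norm_num), ← e]
    refine Real.log_le_log (by positivity) ?_
    have hs : 1 ≤ √(3 * (n : ℝ) + 1) := Real.one_le_sqrt.2 (by linarith [Nat.cast_nonneg (α := ℝ) n])
    have hsq := Real.sq_sqrt (show 0 ≤ 3 * (n : ℝ) + 1 by positivity)
    nlinarith
  rw [Real.log_div (by positivity) (by positivity), Real.log_mul (by norm_num) hπ.ne',
    Real.log_mul two_ne_zero (Real.exp_ne_zero 1), Real.log_exp]
  rw [Real.log_mul two_ne_zero hπ.ne'] at h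
  rw [add_comm (n : ℝ) 1]
  linarith

theorem asymptotic_bound_le_lower_bound {n : ℕ} (hn : 1 ≤ n) :
    1 / 2 * Real.log ((n : ℝ) * Real.pi / (2 * Real.exp 1)) + rLB n
    ≤ digamma ((n : ℝ) + 1) - Real.log (1 + √(3 * (n : ℝ) + 1))
      + 1 / 2 * Real.log (3 * Real.pi / (2 * Real.exp 1)) := by
  have hn' : (0 : ℝ) < n := by positivity
  have hs : 0 < √(3 * (n : ℝ) + 1) := Real.sqrt_pos.2 (by positivity)
  have h := le_digamma_one_add_nat n
  have hπ := Real.pi_pos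
  -- After expansion the claim is `ψ(n+1) ≥ log ((3n+1)/3) - 1/(n+1)`, weaker than `ψ(n+1) ≥ log
  -- (n+1) - 1/(n+1)`.
  have h1 : Real.log (3 * n + 1) ≤ Real.log 3 + Real.log (1 + n) := by
    rw [← Real.log_mul (by norm_num) (by positivity)]
    exact Real.log_le_log (by positivity) (by linarith)
  have h2 : Real.log (1 + n) ≤ Real.log (2 + n) := Real.log_le_log (by positivity) (by linarith)
  have e1 : Real.log (1 + 1 / (3 * (n : ℝ))) = Real.log (3 * n + 1) - Real.log 3 - Real.log n := by
    rw [show 1 + 1 / (3 * (n : ℝ)) = (3 * n + 1) / (3 * n) by field_simp,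
      Real.log_div (by positivity) (by positivity), Real.log_mul (by norm_num) hn'.ne']
    ring
  have e2 : Real.log (1 + 1 / √(3 * (n : ℝ) + 1))
      = Real.log (1 + √(3 * (n : ℝ) + 1)) - Real.log (3 * n + 1) / 2 := by
    rw [show 1 + 1 / √(3 * (n : ℝ) + 1) = (1 + √(3 * (n : ℝ) + 1)) / √(3 * (n : ℝ) + 1) by
      field_simp; ring, Real.log_div (by positivity) hs.ne', Real.log_sqrt (by positivity)]
  rw [rLB, e1, e2, Real.log_div (by positivity) (by positivity), Real.log_mul hn'.ne' hπ.ne',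
    Real.log_div (by positivity) (by positivity), Real.log_mul (by norm_num) hπ.ne',
    add_comm (n : ℝ) 1]
  linarith

theorem tendsto_rLB : Tendsto rLB atTop (𝓝 0) := by
  have h3 : Tendsto (fun n : ℕ => 3 * (n : ℝ)) atTop atTop :=
    tendsto_natCast_atTop_atTop.const_mul_atTop (by norm_num)
  have h1 : Tendsto (fun n : ℕ => 1 + 1 / (3 * (n : ℝ))) atTop (𝓝 (1 + 0)) :=
    (h3.const_div_atTop 1).const_add 1
  have h2 : Tendsto (fun n : ℕ => 1 + 1 / √(3 * (n : ℝ) + 1)) atTop (𝓝 (1 + 0)) :=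
    ((Real.tendsto_sqrt_atTop.comp (tendsto_atTop_add_const_right _ 1 h3)).const_div_atTop
      1).const_add 1
  have h4 : Tendsto (fun n : ℕ => 1 / ((n : ℝ) + 1)) atTop (𝓝 0) :=
    tendsto_one_div_add_atTop_nhds_zero_nat
  have := (((h1.log (by norm_num)).const_mul (1 / 2)).sub (h2.log (by norm_num))).sub h4
  rw [add_zero, Real.log_one, mul_zero, sub_zero, sub_zero] at this
  exact this

/-! ### Mutual information of a channel with countable output -/

theorem klDiv_withDensity_self {α : Type*} [MeasurableSpace α] (ν : Measure α)
    [IsFiniteMeasure ν] {f : α → ℝ≥0∞} (hf : Measurable f) [IsFiniteMeasure (ν.withDensity f)] :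
    klDiv (ν.withDensity f) ν = ∫⁻ x, ENNReal.ofReal (klFun (f x).toReal) ∂ν := by
  rw [klDiv_eq_lintegral_klFun_of_ac (withDensity_absolutelyContinuous ν f)]
  refine lintegral_congr_ae ?_
  filter_upwards [Measure.rnDeriv_withDensity ν hf] with x hx
  rw [hx]

section Countable

variable {𝓧 𝓨 : Type*} [MeasurableSpace 𝓧] [MeasurableSpace 𝓨] [Countable 𝓨]
  [MeasurableSingletonClass 𝓨]

theorem measurable_uncurry_of_countable {β : Type*} [MeasurableSpace β] {f : 𝓧 → 𝓨 → β}
    (hf : ∀ y, Measurable fun x => f x y) : Measurable fun z : 𝓧 × 𝓨 => f z.1 z.2 :=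
  measurable_from_prod_countable_left hf

theorem lintegral_prod_countable (μ : Measure 𝓧) [SFinite μ] (ν : Measure 𝓨) [SFinite ν]
    {f : 𝓧 → 𝓨 → ℝ≥0∞} (hf : ∀ y, Measurable fun x => f x y) :
    ∫⁻ z, f z.1 z.2 ∂(μ.prod ν) = ∑' y, ν {y} * ∫⁻ x, f x y ∂μ := by
  rw [lintegral_prod _ (measurable_uncurry_of_countable hf).aemeasurable]
  simp_rw [lintegral_countable' (μ := ν)]
  rw [lintegral_tsum fun y => ((hf y).mul_const _).aemeasurable]
  refine tsum_congr fun y => ?_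
  rw [lintegral_mul_const _ (hf y), mul_comm]

theorem compProd_eq_withDensity (μ : Measure 𝓧) [IsProbabilityMeasure μ] (κ : Kernel 𝓧 𝓨)
    [IsMarkovKernel κ] :
    μ ⊗ₘ κ = (μ.prod (κ ∘ₘ μ)).withDensity fun z => κ z.1 {z.2} / (κ ∘ₘ μ) {z.2} := by
  have hκ : ∀ y, Measurable fun x => κ x {y} := fun y => κ.measurable_coe (measurableSet_singleton y)
  ext s hs
  have hs' : ∀ y, MeasurableSet {x | (x, y) ∈ s} := fun y => measurable_prodMk_right hs
  have hκ' : ∀ y, Measurable fun x => κ x {y} / (κ ∘ₘ μ) {y} := fun y => (hκ y).div_const _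
  rw [withDensity_apply _ hs, ← lintegral_indicator hs, ← lintegral_indicator_one hs,
    Measure.lintegral_compProd (f := s.indicator 1) (measurable_one.indicator hs)]
  have e : ∀ z : 𝓧 × 𝓨, s.indicator (fun z => κ z.1 {z.2} / (κ ∘ₘ μ) {z.2}) z
      = {x | (x, z.2) ∈ s}.indicator (fun x => κ x {z.2} / (κ ∘ₘ μ) {z.2}) z.1 := fun z => rfl
  simp_rw [e]
  rw [lintegral_prod_countable μ (κ ∘ₘ μ)
    (f := fun x y => {x | (x, y) ∈ s}.indicator (fun x => κ x {y} / (κ ∘ₘ μ) {y}) x)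
    fun y => (hκ' y).indicator (hs' y)]
  have h1 : ∀ x y, s.indicator (1 : 𝓧 × 𝓨 → ℝ≥0∞) (x, y) * κ x {y}
      = {x | (x, y) ∈ s}.indicator (fun x => κ x {y}) x := fun x y => by
    by_cases hx : (x, y) ∈ s <;> simp [hx]
  simp_rw [lintegral_countable', h1]
  rw [lintegral_tsum fun y => ((hκ y).indicator (hs' y)).aemeasurable]
  refine tsum_congr fun y => ?_
  have hν : (κ ∘ₘ μ) {y} = ∫⁻ x, κ x {y} ∂μ :=
    Measure.bind_apply (measurableSet_singleton y) κ.aemeasurable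
  rw [lintegral_indicator (hs' y), lintegral_indicator (hs' y)]
  -- For an output of mass zero both sides vanish, whatever value the quotient takes.
  by_cases h0 : (κ ∘ₘ μ) {y} = 0
  · rw [h0, zero_mul]
    refine le_antisymm ((setLIntegral_le_lintegral _ _).trans ?_) zero_le
    rw [← hν, h0]
  · simp_rw [div_eq_mul_inv]
    rw [lintegral_mul_const _ (hκ y), mul_comm, mul_assoc,
      ENNReal.inv_mul_cancel h0 (measure_ne_top _ _), mul_one]

theorem mutualInfo_eq_tsum (μ : Measure 𝓧) [IsProbabilityMeasure μ] (κ : Kernel 𝓧 𝓨)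
    [IsMarkovKernel κ] :
    mutualInfo μ κ = ∑' y, (κ ∘ₘ μ) {y} *
      ∫⁻ x, ENNReal.ofReal (klFun ((κ x).real {y} / (κ ∘ₘ μ).real {y})) ∂μ := by
  have hκ : ∀ y, Measurable fun x => κ x {y} := fun y => κ.measurable_coe (measurableSet_singleton y)
  have hmeas : Measurable fun z : 𝓧 × 𝓨 => κ z.1 {z.2} / (κ ∘ₘ μ) {z.2} :=
    measurable_uncurry_of_countable (f := fun x y => κ x {y} / (κ ∘ₘ μ) {y})
      fun y => (hκ y).div_const _
  have : IsFiniteMeasure ((μ.prod (κ ∘ₘ μ)).withDensity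
      fun z => κ z.1 {z.2} / (κ ∘ₘ μ) {z.2}) := by
    rw [← compProd_eq_withDensity]
    infer_instance
  rw [mutualInfo, compProd_eq_withDensity, klDiv_withDensity_self _ hmeas]
  simp_rw [ENNReal.toReal_div]
  exact lintegral_prod_countable μ (κ ∘ₘ μ)
    (f := fun x y => ENNReal.ofReal (klFun ((κ x).real {y} / (κ ∘ₘ μ).real {y})))
    fun y => (measurable_klFun.comp ((hκ y).ennreal_toReal.div_const _)).ennreal_ofReal

end Countable

/-- The correction `1 - t` in `klFun t` contributes `q - p`, whose integral is 0. -/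
theorem mul_lintegral_klFun {Ω : Type*} [MeasurableSpace Ω] (μ : Measure Ω)
    [IsProbabilityMeasure μ] {p : Ω → ℝ} (hp : Measurable p) (h0 : ∀ x, 0 ≤ p x)
    (h1 : ∀ x, p x ≤ 1) {q : ℝ} (hq : ∫ x, p x ∂μ = q) :
    ENNReal.ofReal q * ∫⁻ x, ENNReal.ofReal (klFun (p x / q)) ∂μ
      = ENNReal.ofReal (∫ x, p x * Real.log (p x) ∂μ - q * Real.log q) := by
  have hpi : Integrable p μ := Integrable.of_bound hp.aestronglyMeasurable 1
    (ae_of_all _ fun x => by rw [Real.norm_of_nonneg (h0 x)]; exact h1 x)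
  have hq0 : 0 ≤ q := hq ▸ integral_nonneg h0
  have hpl : Integrable (fun x => p x * Real.log (p x)) μ := by
    refine Integrable.of_bound (by fun_prop) 1 (ae_of_all _ fun x => ?_)
    rw [mul_comm]
    rcases (h0 x).eq_or_lt with h | h
    · simp [← h]
    · exact (Real.abs_log_mul_self_lt _ h (h1 x)).le
  rcases hq0.eq_or_lt with h | h
  · have : p =ᵐ[μ] 0 := (integral_eq_zero_iff_of_nonneg h0 hpi).1 (hq.trans h.symm)
    have h2 : ∫ x, p x * Real.log (p x) ∂μ = 0 :=
      integral_eq_zero_of_ae (this.mono fun x hx => by simp [hx])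
    simp [← h, h2]
  · have e : ∀ x, q * klFun (p x / q) = p x * Real.log (p x) - p x * Real.log q + (q - p x) := by
      intro x
      rw [klFun_apply]
      rcases (h0 x).eq_or_lt with h' | h'
      · simp [← h']
      · rw [Real.log_div h'.ne' h.ne']
        field_simp
        ring
    have hi1 : Integrable (fun x => p x * Real.log (p x) - p x * Real.log q) μ :=
      hpl.sub (hpi.mul_const _)
    have hi2 : Integrable (fun x => q - p x) μ := (integrable_const q).sub hpi
    have hi : Integrable (fun x => q * klFun (p x / q)) μ := by
      simp_rw [e]
      exact hi1.add hi2
    rw [← lintegral_const_mul' _ _ ENNReal.ofReal_ne_top]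
    simp_rw [← ENNReal.ofReal_mul hq0]
    rw [← ofReal_integral_eq_lintegral_ofReal hi
      (ae_of_all _ fun x => mul_nonneg hq0 (klFun_nonneg (div_nonneg (h0 x) hq0)))]
    simp_rw [e]
    rw [integral_add hi1 hi2, integral_sub hpl (hpi.mul_const _), integral_mul_const,
      integral_sub (integrable_const q) hpi, hq]
    simp

/-! ### The binomial channel -/

/-- The transition probability `P_{Y|X}(y|x)` of the binomial channel. -/
noncomputable def transition (n y : ℕ) (x : I) : ℝ :=
  (n.choose y : ℝ) * (x : ℝ) ^ y * (1 - (x : ℝ)) ^ (n - y)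

theorem transition_nonneg (n y : ℕ) (x : I) : 0 ≤ transition n y x := by
  rw [transition, ← channel_real_singleton]
  exact measureReal_nonneg

theorem transition_le_one (n y : ℕ) (x : I) : transition n y x ≤ 1 := by
  rw [transition, ← channel_real_singleton]
  exact measureReal_le_one

theorem continuous_transition (n y : ℕ) : Continuous (transition n y) := by
  unfold transition
  fun_prop

theorem integrable_transition (μ : Measure I) [IsFiniteMeasure μ] (n y : ℕ) :
    Integrable (transition n y) μ :=
  (continuous_transition n y).integrable_of_hasCompactSupport (.of_compactSpace _)

theorem sum_transition (n : ℕ) (x : I) : ∑ y ∈ Finset.range (n + 1), transition n y x = 1 := by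
  have := add_pow (x : ℝ) (1 - (x : ℝ)) n
  rw [add_sub_cancel, one_pow] at this
  rw [this]
  exact Finset.sum_congr rfl fun y _ => by rw [transition]; ring

theorem comp_channel_real_singleton (μ : Measure I) [IsProbabilityMeasure μ] (n y : ℕ) :
    (channel n ∘ₘ μ) {y} = ENNReal.ofReal (∫ x, transition n y x ∂μ) := by
  rw [Measure.bind_apply (measurableSet_singleton y) (channel n).aemeasurable,
    ofReal_integral_eq_lintegral_ofReal (integrable_transition μ n y)
      (ae_of_all _ (transition_nonneg n y))]
  refine lintegral_congr fun x => ?_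
  rw [transition, ← channel_real_singleton, measureReal_def,
    ENNReal.ofReal_toReal (measure_ne_top _ _)]

theorem mutualInfo_channel (μ : Measure I) [IsProbabilityMeasure μ] (n : ℕ) :
    mutualInfo μ (channel n) = ∑ y ∈ Finset.range (n + 1),
      ENNReal.ofReal (∫ x, transition n y x * Real.log (transition n y x) ∂μ
        - (∫ x, transition n y x ∂μ) * Real.log (∫ x, transition n y x ∂μ)) := by
  rw [mutualInfo_eq_tsum, tsum_eq_sum (s := Finset.range (n + 1))]
  · refine Finset.sum_congr rfl fun y _ => ?_
    rw [← mul_lintegral_klFun μ (continuous_transition n y).measurable (transition_nonneg n y)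
      (transition_le_one n y) rfl, comp_channel_real_singleton, measureReal_def,
      comp_channel_real_singleton, ENNReal.toReal_ofReal (integral_nonneg (transition_nonneg n y))]
    simp_rw [channel_real_singleton]
    rfl
  · intro y hy
    have : n < y := by
      rw [Finset.mem_range, not_lt] at hy
      exact hy
    rw [comp_channel_real_singleton]
    simp [transition, Nat.choose_eq_zero_of_lt this]

/-- A crude bound, used only for finiteness: `p log p ≤ 0` and `q log q ≥ q - 1` make each summand
at most 1. -/
theorem mutualInfo_channel_le (μ : Measure I) [IsProbabilityMeasure μ] (n : ℕ) :
    mutualInfo μ (channel n) ≤ n + 1 := by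
  rw [mutualInfo_channel]
  refine (Finset.sum_le_card_nsmul _ _ 1 fun y _ => ?_).trans (by simp)
  rw [← ENNReal.ofReal_one]
  refine ENNReal.ofReal_le_ofReal ?_
  have h1 : ∫ x, transition n y x * Real.log (transition n y x) ∂μ ≤ 0 :=
    integral_nonpos fun x => mul_nonpos_of_nonneg_of_nonpos (transition_nonneg n y x)
      (Real.log_nonpos (transition_nonneg n y x) (transition_le_one n y x))
  have h2 : 0 ≤ ∫ x, transition n y x ∂μ := integral_nonneg (transition_nonneg n y)
  have h3 := Real.self_sub_one_le_mul_log h2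
  linarith

theorem capacity_ne_top (n : ℕ) : capacity n ≠ ⊤ :=
  ne_top_of_le_ne_top (by finiteness) (iSup_le fun P => mutualInfo_channel_le (P : Measure I) n)

theorem le_toReal_mutualInfo_channel (μ : Measure I) [IsProbabilityMeasure μ] (n : ℕ) :
    ∑ y ∈ Finset.range (n + 1), (∫ x, transition n y x * Real.log (transition n y x) ∂μ
        - (∫ x, transition n y x ∂μ) * Real.log (∫ x, transition n y x ∂μ))
      ≤ (mutualInfo μ (channel n)).toReal := by
  rw [mutualInfo_channel, ENNReal.toReal_sum fun y _ => ENNReal.ofReal_ne_top]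
  exact Finset.sum_le_sum fun y _ => by
    rw [ENNReal.toReal_ofReal']
    -- `ENNReal.ofReal` truncates at 0, which can only raise a summand, so no appeal to Jensen's
    -- inequality is needed.
    exact le_max_left _ _

/-! ### Moments of the reference input -/

/-- The mixed moment `E[X ^ s * (1 - X) ^ t]` for `X ∼ Beta(1/2, 1/2)`. -/
noncomputable def moment (s t : ℝ) : ℝ :=
  Real.Gamma (1 / 2 + s) * Real.Gamma (1 / 2 + t) / (Real.pi * Real.Gamma (1 + (s + t)))

theorem moment_comm (s t : ℝ) : moment s t = moment t s := by
  rw [moment, moment, add_comm s t, mul_comm (Real.Gamma _)]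

theorem moment_pos {s t : ℝ} (hs : 0 ≤ s) (ht : 0 ≤ t) : 0 < moment s t :=
  div_pos (mul_pos (Real.Gamma_pos_of_pos (by positivity)) (Real.Gamma_pos_of_pos (by positivity)))
    (mul_pos Real.pi_pos (Real.Gamma_pos_of_pos (by positivity)))

theorem measurable_betaPDF (α β : ℝ) : Measurable (betaPDF α β) :=
  (measurable_betaPDFReal α β).ennreal_ofReal

theorem lintegral_referenceInput {f : ℝ → ℝ≥0∞} (hf : Measurable f) :
    ∫⁻ x : I, f x ∂referenceInput = ∫⁻ x, betaPDF (1 / 2) (1 / 2) x * f x := by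
  rw [referenceInput, lintegral_subtype_comap measurableSet_Icc, betaMeasure,
    restrict_withDensity measurableSet_Icc,
    lintegral_withDensity_eq_lintegral_mul _ (measurable_betaPDF _ _) hf]
  refine setLIntegral_eq_of_support_subset fun x hx => ?_
  by_contra h
  refine hx ?_
  rw [Set.mem_Icc, not_and_or, not_le, not_le] at h
  rcases h with h | h
  · simp [betaPDF_eq_zero_of_nonpos h.le]
  · simp [betaPDF_eq_zero_of_one_le h.le]

/-- Tilting the density by `x^s (1-x)^t` gives a multiple of the `Beta(1/2+s, 1/2+t)` density. Real
exponents allow differentiation in `s`. -/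
theorem integral_referenceInput_rpow {s t : ℝ} (hs : 0 ≤ s) (ht : 0 ≤ t) :
    ∫ x : I, (x : ℝ) ^ s * (1 - (x : ℝ)) ^ t ∂referenceInput = moment s t := by
  have hs' : 0 < 1 / 2 + s := by positivity
  have ht' : 0 < 1 / 2 + t := by positivity
  have hβ : beta (1 / 2) (1 / 2) = Real.pi := by
    rw [beta, Real.Gamma_one_half_eq, Real.mul_self_sqrt Real.pi_pos.le, add_halves,
      Real.Gamma_one, div_one]
  have hm : moment s t = beta (1 / 2 + s) (1 / 2 + t) / Real.pi := by
    rw [moment, beta, show 1 / 2 + s + (1 / 2 + t) = 1 + (s + t) by ring, div_div, mul_comm Real.pi]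
  have hβ' := beta_pos hs' ht'
  rw [integral_eq_lintegral_of_nonneg_ae
    (ae_of_all _ fun x => mul_nonneg (Real.rpow_nonneg x.2.1 _)
      (Real.rpow_nonneg (sub_nonneg.2 x.2.2) _)) (by fun_prop),
    lintegral_referenceInput (f := fun x => ENNReal.ofReal (x ^ s * (1 - x) ^ t)) (by fun_prop)]
  have e : ∀ x : ℝ, betaPDF (1 / 2) (1 / 2) x * ENNReal.ofReal (x ^ s * (1 - x) ^ t)
      = ENNReal.ofReal (moment s t) * betaPDF (1 / 2 + s) (1 / 2 + t) x := by
    intro x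
    by_cases hx : 0 < x ∧ x < 1
    · have h1 : 0 < 1 - x := sub_pos.2 hx.2
      rw [betaPDF_of_pos_lt_one hx.1 hx.2, betaPDF_of_pos_lt_one hx.1 hx.2,
        ← ENNReal.ofReal_mul' (by have := hx.1.le; positivity),
        ← ENNReal.ofReal_mul (moment_pos hs ht).le, hβ, hm,
        show 1 / 2 + s - 1 = (1 / 2 - 1) + s by ring, show 1 / 2 + t - 1 = (1 / 2 - 1) + t by ring,
        Real.rpow_add hx.1, Real.rpow_add h1]
      congr 1
      generalize beta (1 / 2 + s) (1 / 2 + t) = c at hβ'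
      field_simp
    · simp [betaPDF_eq, hx]
  simp_rw [e]
  rw [lintegral_const_mul _ (measurable_betaPDF _ _),
    lintegral_betaPDF_eq_one hs' ht', mul_one, ENNReal.toReal_ofReal (moment_pos hs ht).le]

theorem hasDerivAt_moment {s t : ℝ} (hs : 0 ≤ s) (ht : 0 ≤ t) :
    HasDerivAt (fun s => moment s t)
      (moment s t * (digamma (1 / 2 + s) - digamma (1 + (s + t)))) s := by
  have h1 : 0 < 1 / 2 + s := by positivity
  have h2 : 0 < 1 + (s + t) := by positivity
  have hG := (Real.Gamma_pos_of_pos h2).ne'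
  have hd1 := (hasDerivAt_Gamma h1).comp_const_add (1 / 2) s
  have hd2 : HasDerivAt (fun s => Real.Gamma (1 + (s + t)))
      (Real.Gamma (1 + (s + t)) * digamma (1 + (s + t))) s := by
    have := (hasDerivAt_Gamma h2).comp_const_add 1 (s + t)
    exact this.comp_add_const s t
  have := (hd1.mul_const (Real.Gamma (1 / 2 + t))).div (hd2.const_mul Real.pi)
    (mul_ne_zero Real.pi_ne_zero hG)
  refine HasDerivAt.congr_deriv (f := fun s => moment s t) this ?_
  simp only [moment]
  field_simp

/-- Convexity of `s ↦ x^s`: a chord to the left of `a` has slope at most the derivative at `a`. -/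
theorem rpow_sub_rpow_le {x s a : ℝ} (hx : 0 ≤ x) (hs : 0 < s) (hsa : s < a) :
    (x ^ s - x ^ a) / (s - a) ≤ x ^ a * Real.log x := by
  rcases hx.eq_or_lt with rfl | hx
  · simp [Real.zero_rpow hs.ne', Real.zero_rpow (hs.trans hsa).ne']
  · rw [div_le_iff_of_neg (sub_neg.2 hsa)]
    have h1 : x ^ s = x ^ a * Real.exp (Real.log x * (s - a)) := by
      rw [← Real.rpow_def_of_pos hx, ← Real.rpow_add hx, add_sub_cancel]
    have h2 := mul_le_mul_of_nonneg_left (Real.add_one_le_exp (Real.log x * (s - a)))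
      (Real.rpow_nonneg hx.le a)
    rw [h1]
    linarith

theorem abs_pow_mul_log_le {x : ℝ} (h0 : 0 ≤ x) (h1 : x ≤ 1) {a : ℕ} (ha : a ≠ 0) :
    |x ^ a * Real.log x| ≤ 1 := by
  obtain ⟨k, rfl⟩ := Nat.exists_eq_succ_of_ne_zero ha
  rcases h0.eq_or_lt with rfl | h
  · simp
  · rw [pow_succ, mul_assoc, abs_mul, mul_comm x, abs_of_nonneg (pow_nonneg h0 k)]
    exact mul_le_one₀ (pow_le_one₀ h0 h1) (abs_nonneg _) (Real.abs_log_mul_self_lt x h h1).le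

section Log

variable {Ω : Type*} [MeasurableSpace Ω] {μ : Measure Ω} [IsProbabilityMeasure μ] {u v : Ω → ℝ}

theorem integrable_rpow_mul_pow (hu : Measurable u) (hv : Measurable v)
    (hu01 : ∀ x, u x ∈ I) (hv01 : ∀ x, v x ∈ I) {s : ℝ} (hs : 0 ≤ s) (b : ℕ) :
    Integrable (fun x => u x ^ s * v x ^ b) μ := by
  refine Integrable.of_bound (by fun_prop) 1 (ae_of_all _ fun x => ?_)
  have h1 := Real.rpow_nonneg (hu01 x).1 s
  have h2 := pow_nonneg (hv01 x).1 b
  rw [Real.norm_of_nonneg (mul_nonneg h1 h2)]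
  exact mul_le_one₀ (Real.rpow_le_one (hu01 x).1 (hu01 x).2 hs) h2
    (pow_le_one₀ (hv01 x).1 (hv01 x).2)

theorem integrable_pow_mul_log_mul_pow (hu : Measurable u) (hv : Measurable v)
    (hu01 : ∀ x, u x ∈ I) (hv01 : ∀ x, v x ∈ I) {a : ℕ} (ha : a ≠ 0) (b : ℕ) :
    Integrable (fun x => u x ^ a * Real.log (u x) * v x ^ b) μ := by
  refine Integrable.of_bound (by fun_prop) 1 (ae_of_all _ fun x => ?_)
  have h2 := pow_nonneg (hv01 x).1 b
  rw [Real.norm_eq_abs, abs_mul, abs_of_nonneg h2]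
  exact mul_le_one₀ (abs_pow_mul_log_le (hu01 x).1 (hu01 x).2 ha) h2
    (pow_le_one₀ (hv01 x).1 (hv01 x).2)

/-- Only this direction is needed, so differentiation under the integral is avoided: left difference
quotients are bounded pointwise by convexity, integrated, and sent to the limit `s → a`. Taking `u,
v` abstract covers both `log X` and `log (1 - X)`. -/
theorem moment_mul_digamma_sub_le (hu : Measurable u) (hv : Measurable v)
    (hu01 : ∀ x, u x ∈ I) (hv01 : ∀ x, v x ∈ I) {a : ℕ} (ha : a ≠ 0) (b : ℕ)
    (hM : ∀ s : ℝ, 0 ≤ s → ∫ x, u x ^ s * v x ^ b ∂μ = moment s b) :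
    moment a b * (digamma (1 / 2 + a) - digamma (1 + (a + b)))
      ≤ ∫ x, u x ^ a * Real.log (u x) * v x ^ b ∂μ := by
  have ha' : (0 : ℝ) < a := by positivity
  have hlim := ((hasDerivAt_moment ha'.le b.cast_nonneg).tendsto_slope).mono_left
    (nhdsLT_le_nhdsNE (a : ℝ))
  refine le_of_tendsto hlim ?_
  filter_upwards [Ioo_mem_nhdsLT ha'] with s hs
  rw [slope_def_field, ← hM s hs.1.le, ← hM a ha'.le,
    ← integral_sub (integrable_rpow_mul_pow hu hv hu01 hv01 hs.1.le b)
      (integrable_rpow_mul_pow hu hv hu01 hv01 ha'.le b), ← integral_div]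
  refine integral_mono (((integrable_rpow_mul_pow hu hv hu01 hv01 hs.1.le b).sub
    (integrable_rpow_mul_pow hu hv hu01 hv01 ha'.le b)).div_const _)
    (integrable_pow_mul_log_mul_pow hu hv hu01 hv01 ha b) fun x => ?_
  have h := mul_le_mul_of_nonneg_right (rpow_sub_rpow_le (hu01 x).1 hs.1 hs.2)
    (pow_nonneg (hv01 x).1 b)
  rw [Real.rpow_natCast] at h
  simp only [Real.rpow_natCast]
  refine le_of_eq_of_le ?_ h
  ring

/-- The `log`-term of the mutual information; for `a = 0` both sides vanish. -/
theorem natCast_mul_moment_mul_digamma_sub_le (hu : Measurable u) (hv : Measurable v)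
    (hu01 : ∀ x, u x ∈ I) (hv01 : ∀ x, v x ∈ I) (a b : ℕ)
    (hM : ∀ s : ℝ, 0 ≤ s → ∫ x, u x ^ s * v x ^ b ∂μ = moment s b) :
    Integrable (fun x => a * (u x ^ a * Real.log (u x) * v x ^ b)) μ ∧
    a * (moment a b * (digamma (1 / 2 + a) - digamma (1 + (a + b))))
      ≤ ∫ x, a * (u x ^ a * Real.log (u x) * v x ^ b) ∂μ := by
  rcases eq_or_ne a 0 with rfl | ha
  · simp
  · refine ⟨(integrable_pow_mul_log_mul_pow hu hv hu01 hv01 ha b).const_mul _, ?_⟩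
    rw [integral_const_mul]
    exact mul_le_mul_of_nonneg_left (moment_mul_digamma_sub_le hu hv hu01 hv01 ha b hM)
      a.cast_nonneg

end Log

/-! ### The lower bound for the reference input -/

theorem integral_transition_referenceInput (n y : ℕ) :
    ∫ x, transition n y x ∂referenceInput = n.choose y * moment y (n - y : ℕ) := by
  rw [← integral_referenceInput_rpow y.cast_nonneg (n - y).cast_nonneg, ← integral_const_mul]
  simp only [transition, Real.rpow_natCast, mul_assoc]

theorem transition_mul_log_transition {n y : ℕ} (hy : y ≤ n) (x : I) :
    transition n y x * Real.log (transition n y x)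
      = Real.log (n.choose y) * transition n y x + n.choose y *
        (y * ((x : ℝ) ^ y * Real.log x * (1 - x) ^ (n - y))
          + (n - y : ℕ) * ((1 - (x : ℝ)) ^ (n - y) * Real.log (1 - x) * x ^ y)) := by
  have hc : (n.choose y : ℝ) ≠ 0 := by exact_mod_cast (Nat.choose_pos hy).ne'
  unfold transition
  by_cases h1 : (x : ℝ) ^ y = 0
  · simp [h1]
  by_cases h2 : (1 - (x : ℝ)) ^ (n - y) = 0
  · simp [h2]
  rw [Real.log_mul (mul_ne_zero hc h1) h2, Real.log_mul hc h1, Real.log_pow, Real.log_pow]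
  ring

theorem log_moment (a b : ℕ) : Real.log (moment a b) = Real.log (Real.Gamma (1 / 2 + a))
    + Real.log (Real.Gamma (1 / 2 + b)) - Real.log Real.pi - Real.log (a + b).factorial := by
  have h : ∀ k : ℕ, Real.Gamma (1 / 2 + k) ≠ 0 := fun k =>
    (Real.Gamma_pos_of_pos (by positivity)).ne'
  have hf : ((a + b).factorial : ℝ) ≠ 0 := by exact_mod_cast (a + b).factorial_ne_zero
  rw [moment, ← Nat.cast_add, add_comm 1, Real.Gamma_nat_eq_factorial,
    Real.log_div (mul_ne_zero (h a) (h b)) (mul_ne_zero Real.pi_ne_zero hf),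
    Real.log_mul (h a) (h b), Real.log_mul Real.pi_ne_zero hf]
  ring

/-- The factor multiplying `q` does not depend on `y`: the terms `yψ(y+1/2)` and `zψ(z+1/2)` are
absorbed by the two bounds on `log Γ`, and `y + z = n`. -/
theorem mutualInfo_summand_ge {n y : ℕ} (hy : y ≤ n) :
    (∫ x, transition n y x ∂referenceInput) *
        (n - Real.log 2 + Real.log n.factorial - n * digamma ((n : ℝ) + 1))
      ≤ ∫ x, transition n y x * Real.log (transition n y x) ∂referenceInput
        - (∫ x, transition n y x ∂referenceInput)
          * Real.log (∫ x, transition n y x ∂referenceInput) := by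
  obtain ⟨z, rfl⟩ := Nat.exists_eq_add_of_le hy
  have hc : (0 : ℝ) < (y + z).choose y := by exact_mod_cast Nat.choose_pos hy
  have hM : 0 < moment y z := moment_pos y.cast_nonneg z.cast_nonneg
  have h1 : ∀ x : I, (x : ℝ) ∈ I := fun x => x.2
  have h2 : ∀ x : I, 1 - (x : ℝ) ∈ I := fun x => (unitInterval.symm x).2
  obtain ⟨i1, l1⟩ := natCast_mul_moment_mul_digamma_sub_le (μ := referenceInput)
    (u := fun x : I => (x : ℝ)) (v := fun x : I => 1 - (x : ℝ)) (by fun_prop) (by fun_prop) h1 h2 y z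
    fun s hs => by
      rw [← integral_referenceInput_rpow hs z.cast_nonneg]
      simp only [Real.rpow_natCast]
  obtain ⟨i2, l2⟩ := natCast_mul_moment_mul_digamma_sub_le (μ := referenceInput)
    (u := fun x : I => 1 - (x : ℝ)) (v := fun x : I => (x : ℝ)) (by fun_prop) (by fun_prop) h2 h1 z y
    fun s hs => by
      rw [moment_comm, ← integral_referenceInput_rpow y.cast_nonneg hs]
      simp only [Real.rpow_natCast, mul_comm]
  have hint := integral_transition_referenceInput (y + z) y
  simp_rw [transition_mul_log_transition hy]
  rw [Nat.add_sub_cancel_left] at hint ⊢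
  have i12 : Integrable (fun x : I => ((y + z).choose y : ℝ) *
      (y * ((x : ℝ) ^ y * Real.log x * (1 - x) ^ z)
        + z * ((1 - (x : ℝ)) ^ z * Real.log (1 - x) * x ^ y))) referenceInput :=
    (i1.add i2).const_mul _
  rw [integral_add ((integrable_transition _ _ _).const_mul _) i12,
    integral_const_mul, integral_const_mul, integral_add i1 i2, hint,
    Real.log_mul hc.ne' hM.ne', log_moment]
  rw [moment_comm, add_comm (z : ℝ) y] at l2
  have g1 := log_Gamma_half_add_nat_le y
  have g2 := log_Gamma_half_add_nat_le z
  rw [Real.log_mul two_ne_zero Real.pi_ne_zero] at g1 g2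
  have key := mul_le_mul_of_nonneg_left (add_le_add g1 g2) hM.le
  have := mul_le_mul_of_nonneg_left (add_le_add (add_le_add l1 l2) key) hc.le
  push_cast
  rw [add_comm ((y : ℝ) + z) 1]
  linarith

theorem le_toReal_mutualInfo_referenceInput (n : ℕ) :
    n - Real.log 2 + Real.log n.factorial - n * digamma ((n : ℝ) + 1)
      ≤ (mutualInfo referenceInput (channel n)).toReal := by
  refine le_trans ?_ (le_toReal_mutualInfo_channel referenceInput n)
  refine le_of_eq_of_le ?_ (Finset.sum_le_sum fun y hy =>
    mutualInfo_summand_ge (Finset.mem_range_succ_iff.1 hy))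
  rw [← Finset.sum_mul, ← integral_finsetSum _ fun y _ => integrable_transition _ n y]
  simp [sum_transition]

theorem toReal_mutualInfo_referenceInput_le_capacity (n : ℕ) :
    (mutualInfo referenceInput (channel n)).toReal ≤ (capacity n).toReal :=
  ENNReal.toReal_mono (capacity_ne_top n)
    (le_iSup (fun P : ProbabilityMeasure I => mutualInfo (P : Measure I) (channel n))
      ⟨referenceInput, inferInstance⟩)

end BinomialChannel

theorem mainTheorem4 :
    (∀ n : ℕ, 1 ≤ n →
      -- the capacity is a finite number
      BinomialChannel.capacity n ≠ ⊤ ∧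
      -- the explicit lower bound on the capacity
      BinomialChannel.digamma ((n : ℝ) + 1) - Real.log (1 + √(3 * (n : ℝ) + 1))
          + 1 / 2 * Real.log (3 * Real.pi / (2 * Real.exp 1))
        ≤ (BinomialChannel.capacity n).toReal ∧
      -- the same bound already holds for the input Beta(1/2, 1/2)
      BinomialChannel.digamma ((n : ℝ) + 1) - Real.log (1 + √(3 * (n : ℝ) + 1))
          + 1 / 2 * Real.log (3 * Real.pi / (2 * Real.exp 1))
        ≤ (BinomialChannel.mutualInfo BinomialChannel.referenceInput
            (BinomialChannel.channel n)).toReal ∧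
      -- the asymptotic form
      1 / 2 * Real.log ((n : ℝ) * Real.pi / (2 * Real.exp 1)) + BinomialChannel.rLB n
        ≤ (BinomialChannel.capacity n).toReal) ∧
    Filter.Tendsto BinomialChannel.rLB Filter.atTop (nhds 0) := by
  refine ⟨fun n hn => ?_, BinomialChannel.tendsto_rLB⟩
  have h1 := (BinomialChannel.lower_bound_le_log_factorial_sub_digamma hn).trans
    (BinomialChannel.le_toReal_mutualInfo_referenceInput n)
  have h2 := h1.trans (BinomialChannel.toReal_mutualInfo_referenceInput_le_capacity n)
  exact ⟨BinomialChannel.capacity_ne_top n, h2, h1,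
    (BinomialChannel.asymptotic_bound_le_lower_bound hn).trans h2⟩
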